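/- Let $T$ be a locally finite tree (infinite or finite, possibly with leaves) with a root vertex $o$ that is an endpoint of exactly one edge, the root edge $\omega$. For an edge $\alpha\in E(T)$ let $b(\alpha)$ and $e(\alpha)$ be its endpoints, $b(\alpha)$ being the one closer to $o$; for a vertex $x$ let $P(x)$ be the set of edges on the path from $o$ to $x$, and write $\alpha\le\beta$ if $\alpha\in P(e(\beta))$. A leaf is an edge $\alpha$ with no $\beta>\alpha$. The boundary $\partial T$ consists of the half-infinite geodesics starting at $o$ together with the leaves. For $\zeta\in\partial T$ let $P(\zeta)$ be the set of edges of the geodesic $\zeta$ (respectively, if $\zeta$ is a leaf $\alpha$, the set of edges $\beta\le\alpha$). Put $\partial T_\alpha=\{\zeta\in\partial T:\alpha\in P(\zeta)\}$; these sets form a basis of the topology of $\partial T$. Let $1<p<\infty$ and $1/p+1/p'=1$. For $f:E(T)\to[0,\infty)$ and $x\in V(T)\cup\partial T$ let $If(x)=\sum_{\alpha\in P(x)}f(\alpha)\in[0,\infty]$. For an arbitrary set $E\subseteq\partial T$ let $\Omega_E$ be the set of nonnegative $f\in\ell^p(E(T))$ with $If\ge1$ on $E$, and let $c_p(E)=\inf_{f\in\Omega_E}\|f\|_p^p$.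 For a finite positive Borel measure $\mu$ on $\partial T$ let $M(\alpha)=\mu(\partial T_\alpha)$ and $M_p(\alpha)=M(\alpha)^{p'-1}$. The measure $\mu$ is the $p$-equilibrium measure of $E$ if it is supported in $\overline E$, if $M_p$ is the $p$-equilibrium function of $E$ (that is, $M_p$ lies in the closure of $\Omega_E$ in $\ell^p$ and $\|M_p\|_p^p=c_p(E)$), and if $\mu(\overline E)=c_p(E)$. **Theorem.** Let $\mu$ be a finite positive Borel measure on $\partial T$ such that $IM_p<1$ on $V(T)$, and define, for $\alpha\in E(T)$, $$c(\alpha)=\frac{M(\alpha)}{\bigl(1-IM_p(b(\alpha))\bigr)^{p/p'}}.$$ Then $\mu$ is the $p$-equilibrium measure of some set $E\subseteq\partial T$ if and only if, for every $\alpha\in E(T)$, $$c(\alpha)\bigl(1-c(\alpha)^{p'-1}\bigr)=\sum_{\beta>\alpha}c(\beta)^{p'}\prod_{\alpha\le\gamma<\beta}\bigl(1-c(\gamma)^{p'-1}\bigr)^p ,$$ where the equality includes the convergence of the series on the right. -/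

import Mathlib

open scoped NNReal ENNReal

/-- A rooted tree: a connected, acyclic, locally finite graph with a root vertex `root` that is an
endpoint of one and only one edge (the root edge). Leaves are allowed. -/
structure RootEdgeTree (V : Type*) where
  graph : SimpleGraph V
  root : V
  isTree : graph.IsTree
  locallyFinite : ∀ x, (graph.neighborSet x).Finite
  root_unique_neighbor : ∃! x, graph.Adj root x

namespace RootEdgeTree

variable {V : Type*} (T : RootEdgeTree V)

/-- The edges of the tree. Each edge is recorded with its endpoints in the order `b`, `e`, where
`b` is the endpoint closest to the root. -/
@[ext]
structure Edge where
  /-- the beginning vertex -/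
  b : V
  /-- the ending vertex -/
  e : V
  adj : T.graph.Adj b e
  dist_eq : T.graph.dist T.root e = T.graph.dist T.root b + 1

/-- The predecessor set `P(x)` of a vertex `x`: the edges on the path from the root to `x`. -/
def predV (x : V) : Set T.Edge :=
  {α | ∃ w : T.graph.Walk T.root x, w.IsPath ∧ s(α.b, α.e) ∈ w.edges}

/-- `α ≤ β`: the path from the root that ends by crossing `β` crosses `α`. -/
def le (α β : T.Edge) : Prop := α ∈ T.predV β.e

/-- `α < β`. -/
def lt (α β : T.Edge) : Prop := T.le α β ∧ α ≠ β

/-- The edge `α` is a leaf: no edge lies strictly beyond it. -/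
def IsLeaf (α : T.Edge) : Prop := ∀ β, ¬ T.lt α β

/-- The boundary of the tree: the half-infinite geodesics starting at the root, together with
the leaves. -/
inductive Boundary where
  | ray (ζ : ℕ → V) (zero : ζ 0 = T.root) (adj : ∀ n, T.graph.Adj (ζ n) (ζ (n + 1)))
      (inj : Function.Injective ζ) : Boundary
  | leaf (α : T.Edge) (isLeaf : T.IsLeaf α) : Boundary

/-- The predecessor set `P(ζ)` of a boundary point. -/
def predB : T.Boundary → Set T.Edge
  | .ray ζ _ _ _ => {α | ∃ n, α.b = ζ n ∧ α.e = ζ (n + 1)}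
  | .leaf β _ => {α | T.le α β}

/-- The boundary `∂T_α` of the tent rooted in `α`, as a subset of `∂T`. -/
def tentBoundary (α : T.Edge) : Set T.Boundary := {ζ | α ∈ T.predB ζ}

/-- The topology on `∂T` generated by the sets `∂T_α`. -/
instance : TopologicalSpace T.Boundary :=
  TopologicalSpace.generateFrom (Set.range T.tentBoundary)

instance : MeasurableSpace T.Boundary := borel _

instance : BorelSpace T.Boundary := ⟨rfl⟩

/-- The potential `If(x)` at a vertex `x`. -/
noncomputable def potentialV (f : T.Edge → ℝ≥0) (x : V) : ℝ≥0∞ :=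
  ∑' α : T.predV x, (f α : ℝ≥0∞)

/-- The potential `If(ζ)` at a boundary point `ζ`. -/
noncomputable def potentialB (f : T.Edge → ℝ≥0) (ζ : T.Boundary) : ℝ≥0∞ :=
  ∑' α : T.predB ζ, (f α : ℝ≥0∞)

/-- `‖f‖_p ^ p` in `ℓ^p(E(T))`, for nonnegative `f`. -/
noncomputable def normPow (p : ℝ) (f : T.Edge → ℝ≥0) : ℝ≥0∞ :=
  ∑' α, (f α : ℝ≥0∞) ^ p

/-- The class `Ω_E` of the `f ∈ ℓ^p_+` with `If ≥ 1` on `E`. -/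
def Omega (p : ℝ) (E : Set T.Boundary) : Set (T.Edge → ℝ≥0) :=
  {f | T.normPow p f < ∞ ∧ ∀ ζ ∈ E, 1 ≤ T.potentialB f ζ}

/-- The `p`-capacity of a subset of `∂T`. -/
noncomputable def capacity (p : ℝ) (E : Set T.Boundary) : ℝ≥0∞ :=
  ⨅ f ∈ T.Omega p E, T.normPow p f

/-- The closure of `Ω_E` in `ℓ^p`: the edge functions (automatically in `ℓ^p_+`) whose `ℓ^p`
distance to members of `Ω_E` can be made arbitrarily small. -/
def OmegaClosure (p : ℝ) (E : Set T.Boundary) : Set (T.Edge → ℝ≥0) :=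
  {f | ∀ ε : ℝ≥0∞, 0 < ε → ∃ g ∈ T.Omega p E, T.normPow p (fun α => nndist (f α) (g α)) < ε}

/-- `f` is the `p`-equilibrium function of `E`: the element of the `ℓ^p`-closure of `Ω_E` for which
`‖f‖_p ^ p = c_p(E)`. -/
def IsEquilibriumFunction (p : ℝ) (E : Set T.Boundary) (f : T.Edge → ℝ≥0) : Prop :=
  f ∈ T.OmegaClosure p E ∧ T.normPow p f = T.capacity p E

/-- The co-potential `M(α) = μ(∂T_α)`. -/
noncomputable def coPotential (μ : MeasureTheory.FiniteMeasure T.Boundary) (α : T.Edge) : ℝ≥0 :=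
  μ (T.tentBoundary α)

/-- The edge function `M_p = M ^ (p' - 1)`. -/
noncomputable def coPotentialPow (p' : ℝ) (μ : MeasureTheory.FiniteMeasure T.Boundary)
    (α : T.Edge) : ℝ≥0 :=
  T.coPotential μ α ^ (p' - 1)

/-- `μ` is the `p`-equilibrium measure of `E`: it is carried by the closure of `E`, `M_p` is the
`p`-equilibrium function of `E`, and `μ(closure E) = c_p(E) = ‖M_p‖_p ^ p` (the second equality is
part of `IsEquilibriumFunction`). -/
def IsEquilibriumMeasure (p p' : ℝ) (E : Set T.Boundary)
    (μ : MeasureTheory.FiniteMeasure T.Boundary) : Prop :=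
  (μ : MeasureTheory.Measure T.Boundary) (closure E)ᶜ = 0 ∧
  T.IsEquilibriumFunction p E (T.coPotentialPow p' μ) ∧
  (μ : MeasureTheory.Measure T.Boundary) (closure E) = T.capacity p E

/-- The rescaled co-potential `c(α) = M(α) / (1 - IM_p(b(α))) ^ (p / p')`. -/
noncomputable def rescaled (p p' : ℝ) (μ : MeasureTheory.FiniteMeasure T.Boundary)
    (α : T.Edge) : ℝ :=
  (T.coPotential μ α : ℝ) /
    (1 - (T.potentialV (T.coPotentialPow p' μ) α.b).toReal) ^ (p / p')

/-- The predecessor set of a vertex is finite. -/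
theorem predV_finite (x : V) : (T.predV x).Finite := by
  classical
  obtain ⟨w, hw, huniq⟩ := T.isTree.existsUnique_path T.root x
  have hfin : (((fun α : T.Edge => (α.b, α.e)) '' T.predV x)).Finite := by
    refine Set.Finite.subset (s := {q : V × V | q.1 ∈ w.support ∧ q.2 ∈ w.support}) ?_ ?_
    · exact (w.support.finite_toSet).prod (w.support.finite_toSet)
    · rintro q ⟨α, ⟨w', hw', hα⟩, rfl⟩
      obtain rfl := huniq w' hw'
      exact ⟨w'.fst_mem_support_of_mem_edges hα, w'.snd_mem_support_of_mem_edges hα⟩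
  refine Set.Finite.of_finite_image hfin ?_
  intro α _ β _ h
  simp only [Prod.mk.injEq] at h
  exact Edge.ext h.1 h.2

/-- The edges `γ` with `α ≤ γ < β`. -/
def Ico (α β : T.Edge) : Set T.Edge := {γ | T.le α γ ∧ T.lt γ β}

theorem Ico_finite (α β : T.Edge) : (T.Ico α β).Finite :=
  (T.predV_finite β.e).subset fun _ h => h.2.1

end RootEdgeTree

namespace RootEdgeTree

section Order

variable {V : Type*} {T : RootEdgeTree V}

theorem length_eq_dist_of_isPath (T : RootEdgeTree V) {x y : V} {w : T.graph.Walk x y}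
    (hw : w.IsPath) : w.length = T.graph.dist x y := by
  obtain ⟨w', hw'⟩ := T.isTree.connected.exists_walk_length_eq_dist x y
  have h := T.isTree.existsUnique_path x y |>.unique hw (w'.isPath_of_length_eq_dist hw')
  rw [h, hw']

theorem dist_le_of_mem_support_path {x u : V} {w : T.graph.Walk T.root x} (hw : w.IsPath)
    (hu : u ∈ w.support) : T.graph.dist T.root u ≤ T.graph.dist T.root x := by
  classical
  rw [← T.length_eq_dist_of_isPath hw]
  exact (SimpleGraph.dist_le (w.takeUntil u hu)).trans (w.length_takeUntil_le_length hu)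

theorem dist_e_le_of_mem_predV {x : V} {γ : T.Edge} (h : γ ∈ T.predV x) :
    T.graph.dist T.root γ.e ≤ T.graph.dist T.root x := by
  obtain ⟨w, hw, hγ⟩ := h
  exact dist_le_of_mem_support_path hw (w.snd_mem_support_of_mem_edges hγ)

theorem predV_root : T.predV T.root = ∅ := by
  ext γ
  simp only [Set.mem_empty_iff_false, iff_false]
  intro h
  have h1 := dist_e_le_of_mem_predV h
  have h2 := γ.dist_eq
  rw [SimpleGraph.dist_self] at h1
  omega

theorem notMem_predV_b (α : T.Edge) : α ∉ T.predV α.b := fun h => by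
  have h1 := dist_e_le_of_mem_predV h
  have h2 := α.dist_eq
  omega

theorem Edge.eq_of_sym2_eq {α β : T.Edge} (h : s(α.b, α.e) = s(β.b, β.e)) : α = β := by
  rcases Sym2.eq_iff.1 h with ⟨h1, h2⟩ | ⟨h1, h2⟩
  · exact Edge.ext h1 h2
  · have h3 := α.dist_eq
    have h4 := β.dist_eq
    rw [h1, h2] at h3
    omega

theorem predV_e (α : T.Edge) : T.predV α.e = insert α (T.predV α.b) := by
  obtain ⟨w, hw, huniq⟩ := T.isTree.existsUnique_path T.root α.b
  have hnot : α.e ∉ w.support := fun h => by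
    have h1 := dist_le_of_mem_support_path hw h
    have h2 := α.dist_eq
    omega
  have hpath : (w.concat α.adj).IsPath := hw.concat hnot α.adj
  ext γ
  simp only [predV, Set.mem_insert_iff, Set.mem_ofPred_eq]
  constructor
  · rintro ⟨w', hw', hγ⟩
    obtain rfl := (T.isTree.existsUnique_path T.root α.e).unique hw' hpath
    rw [SimpleGraph.Walk.edges_concat, List.concat_eq_append, List.mem_append,
      List.mem_singleton] at hγ
    rcases hγ with hγ | hγ
    · exact Or.inr ⟨w, hw, hγ⟩
    · exact Or.inl (Edge.eq_of_sym2_eq hγ)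
  · rintro (rfl | ⟨w', hw', hγ⟩)
    · exact ⟨_, hpath, by simp [SimpleGraph.Walk.edges_concat]⟩
    · obtain rfl := huniq w' hw'
      exact ⟨_, hpath, by simp [SimpleGraph.Walk.edges_concat, hγ]⟩

/-- Induction along the tree, away from the root. -/
theorem vertex_induction (T : RootEdgeTree V) {P : V → Prop} (root : P T.root)
    (step : ∀ α : T.Edge, P α.b → P α.e) (x : V) : P x := by
  induction h : T.graph.dist T.root x generalizing x with
  | zero =>
    rw [T.isTree.connected.dist_eq_zero_iff] at h
    exact h ▸ root
  | succ n ih =>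
    obtain ⟨w, hw⟩ := T.isTree.connected.exists_walk_length_eq_dist T.root x
    have hnil : ¬ w.Nil := fun hn => by
      have := SimpleGraph.Walk.length_eq_zero_iff.2 hn
      omega
    have hadj := w.adj_penultimate hnil
    have h1 : T.graph.dist T.root w.penultimate ≤ n := by
      refine (SimpleGraph.dist_le w.dropLast).trans ?_
      have : w.dropLast.length = w.length - 1 := by simp
      omega
    have h2 := T.isTree.connected.dist_triangle (u := T.root) (v := w.penultimate) (w := x)
    rw [SimpleGraph.dist_eq_one_iff_adj.2 hadj] at h2
    exact step ⟨w.penultimate, x, hadj, by omega⟩ (ih _ (by simp only; omega))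

theorem le_refl (α : T.Edge) : T.le α α := by
  rw [le, predV_e]
  exact Set.mem_insert _ _

theorem mem_predV_trans {x : V} {β γ : T.Edge} (hγ : T.le γ β) (hβ : β ∈ T.predV x) :
    γ ∈ T.predV x := by
  induction x using T.vertex_induction with
  | root => simp [predV_root] at hβ
  | step α ih =>
    rw [predV_e] at hβ ⊢
    rcases hβ with rfl | hβ
    · rwa [le, predV_e] at hγ
    · exact Or.inr (ih hβ)

theorem le_trans {α β γ : T.Edge} (h : T.le α β) (h' : T.le β γ) : T.le α γ :=
  mem_predV_trans h h'

theorem le_total_of_mem_predV {x : V} {α β : T.Edge} (hα : α ∈ T.predV x) (hβ : β ∈ T.predV x) :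
    T.le α β ∨ T.le β α := by
  induction x using T.vertex_induction with
  | root => simp [predV_root] at hβ
  | step δ ih =>
    by_cases h1 : α = δ
    · exact Or.inr (h1 ▸ hβ)
    by_cases h2 : β = δ
    · exact Or.inl (h2 ▸ hα)
    rw [predV_e] at hα hβ
    exact ih (hα.resolve_left h1) (hβ.resolve_left h2)

theorem lt_iff_mem_predV_b {α β : T.Edge} : T.lt α β ↔ α ∈ T.predV β.b := by
  rw [lt, le, predV_e]
  constructor
  · rintro ⟨h, hne⟩
    exact h.resolve_left hne
  · intro h
    exact ⟨Or.inr h, by rintro rfl; exact notMem_predV_b _ h⟩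

theorem le_antisymm {α β : T.Edge} (h : T.le α β) (h' : T.le β α) : α = β := by
  by_contra hne
  have h1 := dist_e_le_of_mem_predV (lt_iff_mem_predV_b.1 ⟨h, hne⟩)
  have h2 := dist_e_le_of_mem_predV h'
  have h3 := β.dist_eq
  omega

theorem predV_b_eq_union {α β : T.Edge} (h : T.lt α β) :
    T.predV β.b = T.predV α.b ∪ T.Ico α β := by
  ext γ
  simp only [Ico, Set.mem_union, Set.mem_ofPred_eq, ← lt_iff_mem_predV_b]
  constructor
  · intro hγ
    by_cases hαγ : T.le α γ
    · exact Or.inr ⟨hαγ, hγ⟩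
    · rcases le_total_of_mem_predV h.1 hγ.1 with h1 | h1
      · exact absurd h1 hαγ
      · exact Or.inl ⟨h1, by rintro rfl; exact hαγ h1⟩
  · rintro (hγ | hγ)
    · refine ⟨le_trans hγ.1 h.1, ?_⟩
      rintro rfl
      exact hγ.2 (le_antisymm hγ.1 h.1)
    · exact hγ.2

theorem disjoint_predV_b_Ico (α β : T.Edge) : Disjoint (T.predV α.b) (T.Ico α β) := by
  rw [Set.disjoint_left]
  intro γ hγ hγ'
  rw [← lt_iff_mem_predV_b] at hγ
  exact hγ.2 (le_antisymm hγ.1 hγ'.1)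

/-- The root edge precedes all edges. -/
theorem exists_rootEdge (T : RootEdgeTree V) : ∃ ω : T.Edge, ∀ β, T.le ω β := by
  obtain ⟨x, hx, huniq⟩ := T.root_unique_neighbor
  let ω : T.Edge := ⟨T.root, x, hx, by
    rw [SimpleGraph.dist_self, SimpleGraph.dist_eq_one_iff_adj.2 hx]⟩
  have key : ∀ y, y = T.root ∨ ω ∈ T.predV y := by
    intro y
    induction y using T.vertex_induction with
    | root => exact Or.inl rfl
    | step α ih =>
      right
      rw [predV_e]
      rcases ih with h | h
      · left
        refine Edge.ext h.symm (huniq _ ?_).symm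
        have := α.adj
        rwa [h] at this
      · exact Or.inr h
  refine ⟨ω, fun β => (key β.e).resolve_left fun h => ?_⟩
  have := β.dist_eq
  rw [h, SimpleGraph.dist_self] at this
  omega

theorem countable_vertices (T : RootEdgeTree V) : Countable V := by
  have hball : ∀ n : ℕ, {x | T.graph.dist T.root x ≤ n}.Finite := by
    intro n
    induction n with
    | zero =>
      refine (Set.finite_singleton T.root).subset fun x hx => ?_
      simp only [Set.mem_ofPred_eq, nonpos_iff_eq_zero,
        T.isTree.connected.dist_eq_zero_iff] at hx
      exact hx.symm
    | succ n ih =>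
      refine ((ih.biUnion fun x _ => T.locallyFinite x).union (Set.finite_singleton T.root)).subset
        fun x => ?_
      refine T.vertex_induction (P := fun x => T.graph.dist T.root x ≤ n + 1 → x ∈ _) ?_ ?_ x
      · exact fun _ => Or.inr rfl
      · intro α _ hα
        rw [α.dist_eq] at hα
        refine Or.inl (Set.mem_biUnion (x := α.b) ?_ α.adj)
        simp only [Set.mem_ofPred_eq]
        omega
  rw [← Set.countable_univ_iff]
  refine (Set.countable_iUnion fun n => (hball n).countable).mono fun x _ => ?_
  exact Set.mem_iUnion.2 ⟨_, _root_.le_refl (T.graph.dist T.root x)⟩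

theorem countable_edges (T : RootEdgeTree V) : Countable T.Edge := by
  have := T.countable_vertices
  refine Function.Injective.countable (f := fun α : T.Edge => (α.b, α.e)) fun α β h => ?_
  simp only [Prod.mk.injEq] at h
  exact Edge.ext h.1 h.2

theorem dist_ray (ζ : ℕ → V) (h0 : ζ 0 = T.root) (hadj : ∀ n, T.graph.Adj (ζ n) (ζ (n + 1)))
    (hinj : Function.Injective ζ) (n : ℕ) : T.graph.dist T.root (ζ n) = n := by
  have key : ∃ w : T.graph.Walk T.root (ζ n), w.IsPath ∧ w.length = n ∧
      ∀ x ∈ w.support, ∃ k ≤ n, x = ζ k := by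
    induction n with
    | zero =>
      rw [h0]
      exact ⟨SimpleGraph.Walk.nil, by simp, rfl, fun x hx =>
        ⟨0, _root_.le_refl _, by simpa [h0] using hx⟩⟩
    | succ n ih =>
      obtain ⟨w, hw, hlen, hsupp⟩ := ih
      refine ⟨w.concat (hadj n), hw.concat ?_ _, by simp [hlen], fun x hx => ?_⟩
      · intro h
        obtain ⟨k, hk, h⟩ := hsupp _ h
        have := hinj h
        omega
      · rw [SimpleGraph.Walk.support_concat, List.mem_append, List.mem_singleton] at hx
        rcases hx with hx | rfl
        · obtain ⟨k, hk, h⟩ := hsupp _ hx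
          exact ⟨k, by omega, h⟩
        · exact ⟨n + 1, _root_.le_refl _, rfl⟩
  obtain ⟨w, hw, hlen, -⟩ := key
  rw [← T.length_eq_dist_of_isPath hw, hlen]

/-- The predecessor set of a boundary point is exhausted by those of an increasing sequence of
edges. -/
theorem exists_exhaustion_predB (ζ : T.Boundary) :
    ∃ ε : ℕ → T.Edge, Monotone (fun n => T.predV (ε n).e) ∧
      T.predB ζ = ⋃ n, T.predV (ε n).e := by
  cases ζ with
  | leaf α hα => exact ⟨fun _ => α, monotone_const, by rw [Set.iUnion_const]; rfl⟩
  | ray ζ h0 hadj hinj =>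
    let ε : ℕ → T.Edge := fun n => ⟨ζ n, ζ (n + 1), hadj n, by
      rw [dist_ray ζ h0 hadj hinj, dist_ray ζ h0 hadj hinj]⟩
    have hmem : ∀ n γ, γ ∈ T.predV (ζ n) ↔ ∃ k < n, γ = ε k := by
      intro n γ
      induction n with
      | zero => simp [h0, predV_root]
      | succ n ih =>
        have := predV_e (ε n)
        simp only [ε] at this
        rw [this, Set.mem_insert_iff, ih]
        constructor
        · rintro (rfl | ⟨k, hk, rfl⟩)
          · exact ⟨n, by omega, rfl⟩
          · exact ⟨k, by omega, rfl⟩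
        · rintro ⟨k, hk, rfl⟩
          rcases Nat.lt_succ_iff_lt_or_eq.1 hk with hk | rfl
          · exact Or.inr ⟨k, hk, rfl⟩
          · exact Or.inl rfl
    refine ⟨ε, fun m n hmn γ => ?_, ?_⟩
    · simp only [ε, hmem]
      rintro ⟨k, hk, rfl⟩
      exact ⟨k, by omega, rfl⟩
    · ext γ
      simp only [predB, ε, Set.mem_iUnion, hmem, Set.mem_ofPred_eq]
      constructor
      · rintro ⟨n, h1, h2⟩
        exact ⟨n, n, by omega, Edge.ext h1 h2⟩
      · rintro ⟨_, k, _, rfl⟩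
        exact ⟨k, rfl, rfl⟩

theorem tentBoundary_subset {α β : T.Edge} (h : T.le α β) :
    T.tentBoundary β ⊆ T.tentBoundary α := by
  intro ζ (hζ : β ∈ T.predB ζ)
  change α ∈ T.predB ζ
  obtain ⟨ε, -, hε⟩ := exists_exhaustion_predB ζ
  rw [hε, Set.mem_iUnion] at hζ ⊢
  obtain ⟨n, hn⟩ := hζ
  exact ⟨n, mem_predV_trans h hn⟩

theorem tentBoundary_inter_eq_empty {α β : T.Edge} (h : ¬ T.le α β) (h' : ¬ T.le β α) :
    T.tentBoundary α ∩ T.tentBoundary β = ∅ := by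
  rw [Set.eq_empty_iff_forall_notMem]
  rintro ζ ⟨hα, hβ⟩
  obtain ⟨ε, hmono, hε⟩ := exists_exhaustion_predB ζ
  simp only [tentBoundary, Set.mem_ofPred_eq, hε, Set.mem_iUnion] at hα hβ
  obtain ⟨m, hm⟩ := hα
  obtain ⟨n, hn⟩ := hβ
  rcases le_total_of_mem_predV (hmono (le_max_left m n) hm) (hmono (le_max_right m n) hn)
    with h1 | h1
  exacts [h h1, h' h1]

theorem tentBoundary_eq_univ {ω : T.Edge} (hω : ∀ β, T.le ω β) : T.tentBoundary ω = Set.univ := by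
  refine Set.eq_univ_of_forall fun ζ => ?_
  obtain ⟨ε, -, hε⟩ := exists_exhaustion_predB ζ
  change ω ∈ T.predB ζ
  rw [hε]
  exact Set.mem_iUnion.2 ⟨0, hω _⟩

theorem measurableSet_tentBoundary (α : T.Edge) : MeasurableSet (T.tentBoundary α) :=
  have h : IsOpen (T.tentBoundary α) :=
    TopologicalSpace.isOpen_generateFrom_of_mem (Set.mem_range_self α)
  h.measurableSet

end Order

section Potential

open MeasureTheory

variable {V : Type*} {T : RootEdgeTree V}

theorem potentialV_root (f : T.Edge → ℝ≥0) : T.potentialV f T.root = 0 := by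
  rw [potentialV, predV_root]
  simp

theorem potentialV_e (f : T.Edge → ℝ≥0) (α : T.Edge) :
    T.potentialV f α.e = f α + T.potentialV f α.b := by
  rw [potentialV, potentialV, predV_e, Set.insert_eq,
    ENNReal.summable.tsum_union_disjoint (f := fun α : T.Edge => (f α : ℝ≥0∞))
      (Set.disjoint_singleton_left.2 (notMem_predV_b α)) ENNReal.summable,
    tsum_singleton α (fun α : T.Edge => (f α : ℝ≥0∞))]

/-- A bound for the potential on the vertices is one on the boundary. -/
theorem potentialB_le {f : T.Edge → ℝ≥0} {C : ℝ≥0∞} (h : ∀ x, T.potentialV f x ≤ C)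
    (ζ : T.Boundary) : T.potentialB f ζ ≤ C := by
  obtain ⟨ε, hmono, hε⟩ := exists_exhaustion_predB ζ
  rw [potentialB, tsum_subtype (T.predB ζ) (fun α => (f α : ℝ≥0∞)), hε, ENNReal.tsum_eq_iSup_sum]
  refine iSup_le fun s => ?_
  have hn : ∃ n, ∀ α ∈ s, α ∈ (⋃ n, T.predV (ε n).e) → α ∈ T.predV (ε n).e := by
    classical
    induction s using Finset.induction_on with
    | empty => exact ⟨0, by simp⟩
    | insert a s _ ih =>
      obtain ⟨n, hn⟩ := ih
      by_cases ha : a ∈ ⋃ n, T.predV (ε n).e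
      · obtain ⟨m, hm⟩ := Set.mem_iUnion.1 ha
        refine ⟨max m n, fun α hα hα' => ?_⟩
        rcases Finset.mem_insert.1 hα with rfl | hα
        · exact hmono (le_max_left m n) hm
        · exact hmono (le_max_right m n) (hn α hα hα')
      · refine ⟨n, fun α hα hα' => ?_⟩
        rcases Finset.mem_insert.1 hα with rfl | hα
        · exact absurd hα' ha
        · exact hn α hα hα'
  obtain ⟨n, hn⟩ := hn
  calc ∑ α ∈ s, (⋃ n, T.predV (ε n).e).indicator (fun α => (f α : ℝ≥0∞)) α
      ≤ ∑ α ∈ s, (T.predV (ε n).e).indicator (fun α => (f α : ℝ≥0∞)) α := by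
        refine Finset.sum_le_sum fun α hα => ?_
        by_cases h' : α ∈ ⋃ n, T.predV (ε n).e
        · rw [Set.indicator_of_mem h', Set.indicator_of_mem (hn α hα h')]
        · rw [Set.indicator_of_notMem h']
          exact zero_le
    _ ≤ ∑' α, (T.predV (ε n).e).indicator (fun α => (f α : ℝ≥0∞)) α := ENNReal.sum_le_tsum s
    _ = T.potentialV f (ε n).e := by
        rw [potentialV, tsum_subtype (T.predV (ε n).e) (fun α => (f α : ℝ≥0∞))]
    _ ≤ C := h _

theorem potentialB_eq_tsum (f : T.Edge → ℝ≥0) :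
    T.potentialB f = fun ζ => ∑' β, (T.tentBoundary β).indicator (fun _ => (f β : ℝ≥0∞)) ζ := by
  funext ζ
  rw [potentialB, tsum_subtype (T.predB ζ) (fun α => (f α : ℝ≥0∞))]
  rfl

theorem setLIntegral_potentialB (f : T.Edge → ℝ≥0) (μ : Measure T.Boundary)
    (s : Set T.Boundary) :
    ∫⁻ ζ in s, T.potentialB f ζ ∂μ = ∑' β, f β * μ (T.tentBoundary β ∩ s) := by
  have := T.countable_edges
  rw [potentialB_eq_tsum, lintegral_tsum fun β =>
    (measurable_const.indicator (measurableSet_tentBoundary β)).aemeasurable]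
  refine tsum_congr fun β => ?_
  rw [lintegral_indicator_const (measurableSet_tentBoundary β),
    Measure.restrict_apply (measurableSet_tentBoundary β)]

theorem setLIntegral_tentBoundary_potentialB (f : T.Edge → ℝ≥0) (μ : Measure T.Boundary)
    (α : T.Edge) :
    ∫⁻ ζ in T.tentBoundary α, T.potentialB f ζ ∂μ =
      μ (T.tentBoundary α) * T.potentialV f α.e +
        ∑' β : {β // T.lt α β}, f β * μ (T.tentBoundary β) := by
  rw [setLIntegral_potentialB, potentialV, ← ENNReal.tsum_mul_left,
    tsum_subtype (T.predV α.e) (fun β => μ (T.tentBoundary α) * (f β : ℝ≥0∞)),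
    show (∑' β : {β // T.lt α β}, f β * μ (T.tentBoundary β)) = _ from
      tsum_subtype {β | T.lt α β} (fun β => f β * μ (T.tentBoundary β)), ← ENNReal.tsum_add]
  refine tsum_congr fun β => ?_
  by_cases h1 : β ∈ T.predV α.e
  · have h2 : β ∉ {β | T.lt α β} := fun h => h.2 (le_antisymm h.1 h1)
    rw [Set.indicator_of_mem h1, Set.indicator_of_notMem h2, add_zero,
      Set.inter_eq_right.2 (tentBoundary_subset h1), mul_comm]
  · rw [Set.indicator_of_notMem h1, zero_add]
    by_cases h2 : T.lt α β
    · rw [Set.indicator_of_mem (show β ∈ {β | T.lt α β} from h2),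
        Set.inter_eq_left.2 (tentBoundary_subset h2.1)]
    · rw [Set.indicator_of_notMem (show β ∉ {β | T.lt α β} from h2),
        tentBoundary_inter_eq_empty h1, measure_empty, mul_zero]
      intro h
      refine h2 ⟨h, ?_⟩
      rintro rfl
      exact h1 (le_refl _)

theorem lintegral_potentialB (f : T.Edge → ℝ≥0) (μ : Measure T.Boundary) :
    ∫⁻ ζ, T.potentialB f ζ ∂μ = ∑' β, f β * μ (T.tentBoundary β) := by
  simpa using setLIntegral_potentialB f μ Set.univ

theorem coe_coPotential (μ : FiniteMeasure T.Boundary) (α : T.Edge) :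
    (T.coPotential μ α : ℝ≥0∞) = (μ : Measure T.Boundary) (T.tentBoundary α) :=
  FiniteMeasure.ennreal_coeFn_eq_coeFn_toMeasure μ _

theorem coPotentialPow_mul_coPotential {p' : ℝ} (hp' : p' ≠ 0) (μ : FiniteMeasure T.Boundary)
    (α : T.Edge) : T.coPotentialPow p' μ α * T.coPotential μ α = T.coPotential μ α ^ p' := by
  have h := NNReal.rpow_add_one' (x := T.coPotential μ α) (y := p' - 1) (by simpa using hp')
  rw [sub_add_cancel] at h
  rw [coPotentialPow, h]

/-- The energy of a measure is the integral of its potential. -/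
theorem normPow_coPotentialPow {p p' : ℝ} (h : p.HolderConjugate p')
    (μ : FiniteMeasure T.Boundary) :
    T.normPow p (T.coPotentialPow p' μ) =
      ∫⁻ ζ, T.potentialB (T.coPotentialPow p' μ) ζ ∂(μ : Measure T.Boundary) := by
  rw [lintegral_potentialB, normPow]
  refine tsum_congr fun α => ?_
  rw [← coe_coPotential, ← ENNReal.coe_mul, coPotentialPow_mul_coPotential h.symm.ne_zero,
    coPotentialPow, ← ENNReal.coe_rpow_of_nonneg _ h.nonneg, ← NNReal.rpow_mul,
    h.symm.sub_one_mul_conj]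

/-- The measures whose energy is at most their mass bound the capacity from below. -/
theorem le_capacity {p p' : ℝ} (h : p.HolderConjugate p') (μ : FiniteMeasure T.Boundary)
    (hμ : T.normPow p (T.coPotentialPow p' μ) ≤ (μ : Measure T.Boundary) Set.univ)
    {E : Set T.Boundary} (hE : ∀ᵐ ζ ∂(μ : Measure T.Boundary), ζ ∈ E) :
    (μ : Measure T.Boundary) Set.univ ≤ T.capacity p E := by
  refine le_iInf₂ fun f hf => ?_
  set m := (μ : Measure T.Boundary) Set.univ
  have hm : m ≠ ∞ := measure_ne_top _ _
  have h0 : ENNReal.ofReal p ≠ 0 := by simpa using h.pos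
  have h0' : ENNReal.ofReal p' ≠ 0 := by simpa using h.symm.pos
  have hpow : T.normPow p (T.coPotentialPow p' μ) =
      ∑' α, (T.coPotential μ α : ℝ≥0∞) ^ p' := by
    refine tsum_congr fun α => ?_
    rw [coPotentialPow, ← ENNReal.coe_rpow_of_nonneg _ h.nonneg, ← NNReal.rpow_mul,
      h.symm.sub_one_mul_conj, ENNReal.coe_rpow_of_nonneg _ h.symm.nonneg]
  have h1 : m ≤ T.normPow p f / ENNReal.ofReal p + m / ENNReal.ofReal p' := calc
    m = ∫⁻ _, 1 ∂(μ : Measure T.Boundary) := by rw [lintegral_one]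
    _ ≤ ∫⁻ ζ, T.potentialB f ζ ∂(μ : Measure T.Boundary) :=
        lintegral_mono_ae (hE.mono fun ζ hζ => hf.2 ζ hζ)
    _ = ∑' α, (f α : ℝ≥0∞) * T.coPotential μ α := by
        rw [lintegral_potentialB]
        simp only [coe_coPotential]
    _ ≤ ∑' α, ((f α : ℝ≥0∞) ^ p / ENNReal.ofReal p +
          (T.coPotential μ α : ℝ≥0∞) ^ p' / ENNReal.ofReal p') :=
        ENNReal.tsum_le_tsum fun α => ENNReal.young_inequality _ _ h
    _ = T.normPow p f / ENNReal.ofReal p +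
          T.normPow p (T.coPotentialPow p' μ) / ENNReal.ofReal p' := by
        rw [ENNReal.tsum_add, hpow, normPow]
        simp only [div_eq_mul_inv, ENNReal.tsum_mul_right]
    _ ≤ _ := by gcongr
  have h2 : m / ENNReal.ofReal p + m / ENNReal.ofReal p' = m := by
    rw [div_eq_mul_inv, div_eq_mul_inv, ← mul_add, ← ENNReal.ofReal_inv_of_pos h.pos,
      ← ENNReal.ofReal_inv_of_pos h.symm.pos,
      ← ENNReal.ofReal_add h.inv_nonneg h.symm.inv_nonneg, h.inv_add_inv_eq_one,
      ENNReal.ofReal_one, mul_one]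
  have h3 : m / ENNReal.ofReal p + m / ENNReal.ofReal p' ≤
      T.normPow p f / ENNReal.ofReal p + m / ENNReal.ofReal p' := h2.le.trans h1
  have h4 := (ENNReal.add_le_add_iff_right (ENNReal.div_ne_top hm h0')).1 h3
  rwa [ENNReal.div_le_iff h0 ENNReal.ofReal_ne_top,
    ENNReal.div_mul_cancel h0 ENNReal.ofReal_ne_top] at h4

/-- A measure whose potential is less than one on the vertices is an equilibrium measure if and
only if its potential equals one almost everywhere. -/
theorem exists_isEquilibriumMeasure_iff {p p' : ℝ} (h : p.HolderConjugate p')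
    (μ : FiniteMeasure T.Boundary)
    (hμ : ∀ x : V, T.potentialV (T.coPotentialPow p' μ) x < 1) :
    (∃ E : Set T.Boundary, T.IsEquilibriumMeasure p p' E μ) ↔
      T.potentialB (T.coPotentialPow p' μ) =ᵐ[(μ : Measure T.Boundary)] fun _ => 1 := by
  have hle := potentialB_le fun x => (hμ x).le
  constructor
  · rintro ⟨E, h1, h2, h3⟩
    refine ae_eq_of_ae_le_of_lintegral_le (Filter.Eventually.of_forall hle) ?_
      aemeasurable_const ?_
    · rw [← normPow_coPotentialPow h, h2.2, ← h3]
      exact measure_ne_top _ _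
    · rw [← normPow_coPotentialPow h, h2.2, ← h3, lintegral_one, ← Set.union_compl_self (closure E)]
      exact (measure_union_le _ _).trans (by rw [h1, add_zero])
  · intro hae
    have hnorm : T.normPow p (T.coPotentialPow p' μ) = (μ : Measure T.Boundary) Set.univ := by
      rw [normPow_coPotentialPow h, lintegral_congr_ae hae, lintegral_one]
    let E := {ζ | T.potentialB (T.coPotentialPow p' μ) ζ = 1}
    have hΩ : T.coPotentialPow p' μ ∈ T.Omega p E :=
      ⟨hnorm ▸ measure_lt_top _ _, fun ζ hζ => (show _ = _ from hζ).ge⟩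
    have hcap : (μ : Measure T.Boundary) Set.univ = T.capacity p E :=
      _root_.le_antisymm (le_capacity h μ hnorm.le hae) ((iInf₂_le _ hΩ).trans hnorm.le)
    have hE : (μ : Measure T.Boundary) (closure E)ᶜ = 0 :=
      measure_mono_null (Set.compl_subset_compl.2 subset_closure) hae
    refine ⟨E, hE, ⟨fun ε hε => ⟨_, hΩ, ?_⟩, hnorm.trans hcap⟩, ?_⟩
    · simpa [normPow, h.pos] using hε
    · rw [← hcap, measure_of_measure_compl_eq_zero hE]

/-- The potential equals one almost everywhere if and only if the energies of the tents satisfy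
the rescaling-free identity. -/
theorem potentialB_ae_eq_one_iff {p' : ℝ} (hp' : p' ≠ 0) (μ : FiniteMeasure T.Boundary)
    (hμ : ∀ x : V, T.potentialV (T.coPotentialPow p' μ) x < 1) :
    T.potentialB (T.coPotentialPow p' μ) =ᵐ[(μ : Measure T.Boundary)] (fun _ => 1) ↔
      ∀ α : T.Edge, ∑' β : {β // T.lt α β}, ((T.coPotential μ β ^ p' : ℝ≥0) : ℝ≥0∞) =
        T.coPotential μ α * (1 - T.potentialV (T.coPotentialPow p' μ) α.e) := by
  have hint : ∀ α, ∫⁻ ζ in T.tentBoundary α, T.potentialB (T.coPotentialPow p' μ) ζ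
        ∂(μ : Measure T.Boundary) =
      T.coPotential μ α * T.potentialV (T.coPotentialPow p' μ) α.e +
        ∑' β : {β // T.lt α β}, ((T.coPotential μ β ^ p' : ℝ≥0) : ℝ≥0∞) := fun α => by
    rw [setLIntegral_tentBoundary_potentialB]
    simp only [← coe_coPotential, ← ENNReal.coe_mul, coPotentialPow_mul_coPotential hp']
  have hfin : ∀ α : T.Edge, T.coPotential μ α * T.potentialV (T.coPotentialPow p' μ) α.e ≠ ∞ :=
    fun α => ENNReal.mul_ne_top ENNReal.coe_ne_top ((hμ _).trans ENNReal.one_lt_top).ne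
  have hsum : ∀ α : T.Edge, T.coPotential μ α * T.potentialV (T.coPotentialPow p' μ) α.e +
      T.coPotential μ α * (1 - T.potentialV (T.coPotentialPow p' μ) α.e) =
        T.coPotential μ α := fun α => by
    rw [← mul_add, add_tsub_cancel_of_le (hμ _).le, mul_one]
  constructor
  · intro hae α
    have h1 := hint α
    rw [lintegral_congr_ae (ae_restrict_of_ae hae), setLIntegral_one, ← coe_coPotential] at h1
    exact ((ENNReal.add_right_inj (hfin α)).1 ((hsum α).trans h1)).symm
  · intro hid
    obtain ⟨ω, hω⟩ := T.exists_rootEdge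
    have h1 := hint ω
    rw [hid, hsum, coe_coPotential, tentBoundary_eq_univ hω, Measure.restrict_univ] at h1
    refine ae_eq_of_ae_le_of_lintegral_le
      (Filter.Eventually.of_forall (potentialB_le fun x => (hμ x).le)) ?_ aemeasurable_const ?_
    · rw [h1]
      exact measure_ne_top _ _
    · rw [h1, lintegral_one]

end Potential

section Rescaling

open MeasureTheory

variable {V : Type*} {T : RootEdgeTree V}

theorem prod_predV_div {F : V → ℝ} (hF : ∀ x, F x ≠ 0) (hroot : F T.root = 1) (x : V) :
    ∏ γ ∈ (T.predV_finite x).toFinset, F γ.e / F γ.b = F x := by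
  classical
  induction x using T.vertex_induction with
  | root =>
    rw [hroot]
    refine Finset.prod_eq_one fun γ hγ => ?_
    rw [Set.Finite.mem_toFinset, predV_root] at hγ
    exact absurd hγ (Set.notMem_empty _)
  | step α ih =>
    have h1 : (T.predV_finite α.e).toFinset = insert α (T.predV_finite α.b).toFinset := by
      ext γ
      simp [predV_e]
    rw [h1, Finset.prod_insert (by simpa using notMem_predV_b α), ih, div_mul_cancel₀ _ (hF _)]

theorem prod_Ico_div {F : V → ℝ} (hF : ∀ x, F x ≠ 0) (hroot : F T.root = 1) {α β : T.Edge}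
    (h : T.lt α β) :
    ∏ γ ∈ (T.Ico_finite α β).toFinset, F γ.e / F γ.b = F β.b / F α.b := by
  classical
  have h1 : (T.predV_finite β.b).toFinset =
      (T.predV_finite α.b).toFinset ∪ (T.Ico_finite α β).toFinset := by
    ext γ
    simp [predV_b_eq_union h]
  have h2 := prod_predV_div hF hroot β.b
  rw [h1, Finset.prod_union, prod_predV_div hF hroot] at h2
  · rw [← h2, mul_div_cancel_left₀ _ (hF _)]
  · simpa using disjoint_predV_b_Ico α β

theorem hasSum_coe_iff_tsum_eq {ι : Type*} {f : ι → ℝ≥0} {a : ℝ≥0∞} (ha : a ≠ ∞) :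
    HasSum (fun i => (f i : ℝ)) a.toReal ↔ ∑' i, (f i : ℝ≥0∞) = a := by
  lift a to ℝ≥0 using ha
  rw [ENNReal.coe_toReal, NNReal.hasSum_coe, ← ENNReal.hasSum_coe, ENNReal.summable.hasSum_iff]

/-- The rescaled co-potential satisfies the equation at `α` if and only if the
co-potential satisfies the corresponding equation for the energy of the tent of `α`. -/
theorem hasSum_rescaled_iff {p p' : ℝ} (h : p.HolderConjugate p') (μ : FiniteMeasure T.Boundary)
    (hμ : ∀ x : V, T.potentialV (T.coPotentialPow p' μ) x < 1) (α : T.Edge) :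
    HasSum
        (fun β : {β : T.Edge // T.lt α β} =>
          T.rescaled p p' μ β ^ p' *
            ∏ γ ∈ (T.Ico_finite α β).toFinset, (1 - T.rescaled p p' μ γ ^ (p' - 1)) ^ p)
        (T.rescaled p p' μ α * (1 - T.rescaled p p' μ α ^ (p' - 1))) ↔
      ∑' β : {β // T.lt α β}, ((T.coPotential μ β ^ p' : ℝ≥0) : ℝ≥0∞) =
        T.coPotential μ α * (1 - T.potentialV (T.coPotentialPow p' μ) α.e) := by
  set F : V → ℝ := fun x => 1 - (T.potentialV (T.coPotentialPow p' μ) x).toReal with hFdef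
  have htop : ∀ x, T.potentialV (T.coPotentialPow p' μ) x ≠ ∞ := fun x =>
    ((hμ x).trans ENNReal.one_lt_top).ne
  have hF : ∀ x, 0 < F x := fun x => by
    have := (ENNReal.toReal_lt_toReal (htop x) ENNReal.one_ne_top).2 (hμ x)
    rw [ENNReal.toReal_one] at this
    exact sub_pos.2 this
  have hroot : F T.root = 1 := by simp [hFdef, potentialV_root]
  have hFe : ∀ γ : T.Edge, F γ.e = F γ.b - (T.coPotential μ γ : ℝ) ^ (p' - 1) := fun γ => by
    simp only [hFdef]
    rw [potentialV_e, ENNReal.toReal_add ENNReal.coe_ne_top (htop _), ENNReal.coe_toReal,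
      coPotentialPow, NNReal.coe_rpow]
    ring
  have hc : ∀ γ, T.rescaled p p' μ γ = (T.coPotential μ γ : ℝ) / F γ.b ^ (p / p') := fun _ => rfl
  have hexp : p / p' * (p' - 1) = 1 := by
    have h1 := h.symm.sub_one_mul_conj
    have h2 := h.symm.ne_zero
    field_simp
    linarith
  have hone : ∀ γ, 1 - T.rescaled p p' μ γ ^ (p' - 1) = F γ.e / F γ.b := fun γ => by
    rw [hc, Real.div_rpow (NNReal.coe_nonneg _) (Real.rpow_nonneg (hF _).le _),
      ← Real.rpow_mul (hF _).le, hexp, Real.rpow_one, hFe, sub_div, div_self (hF _).ne']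
  have hterm : ∀ β : {β : T.Edge // T.lt α β}, T.rescaled p p' μ β ^ p' *
      ∏ γ ∈ (T.Ico_finite α β).toFinset, (1 - T.rescaled p p' μ γ ^ (p' - 1)) ^ p =
      ((T.coPotential μ β ^ p' : ℝ≥0) : ℝ) / F α.b ^ p := fun β => by
    simp only [hone]
    rw [Real.finsetProd_rpow _ _ fun γ _ => (div_pos (hF _) (hF _)).le,
      prod_Ico_div (fun x => (hF x).ne') hroot β.2, hc,
      Real.div_rpow (NNReal.coe_nonneg _) (Real.rpow_nonneg (hF _).le _),
      ← Real.rpow_mul (hF _).le, div_mul_cancel₀ _ h.symm.ne_zero,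
      Real.div_rpow (hF _).le (hF _).le, NNReal.coe_rpow,
      div_mul_div_cancel₀ (Real.rpow_pos_of_pos (hF _) _).ne']
  have hpp : p / p' + 1 = p := by
    rw [h.div_conj_eq_sub_one]
    ring
  have hleft : T.rescaled p p' μ α * (1 - T.rescaled p p' μ α ^ (p' - 1)) =
      (T.coPotential μ α * F α.e) / F α.b ^ p := by
    rw [hone, hc, div_mul_div_comm, ← Real.rpow_add_one (hF _).ne', hpp]
  have hreal : (T.coPotential μ α : ℝ) * F α.e = ((T.coPotential μ α : ℝ≥0∞) *
      (1 - T.potentialV (T.coPotentialPow p' μ) α.e)).toReal := by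
    rw [ENNReal.toReal_mul, ENNReal.coe_toReal, ENNReal.toReal_sub_of_le (hμ _).le
      ENNReal.one_ne_top, ENNReal.toReal_one]
  rw [hleft, funext hterm, hasSum_div_const_iff (Real.rpow_pos_of_pos (hF _) _).ne', hreal]
  exact hasSum_coe_iff_tsum_eq (ENNReal.mul_ne_top ENNReal.coe_ne_top
    (ENNReal.sub_ne_top ENNReal.one_ne_top))

end Rescaling

end RootEdgeTree

theorem mainTheorem6 {V : Type*} (T : RootEdgeTree V) (p p' : ℝ) (hp : 1 < p)
    (hpp' : 1 / p + 1 / p' = 1)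
    (μ : MeasureTheory.FiniteMeasure T.Boundary)
    (hμ : ∀ x : V, T.potentialV (T.coPotentialPow p' μ) x < 1) :
    (∃ E : Set T.Boundary, T.IsEquilibriumMeasure p p' E μ) ↔
      ∀ α : T.Edge,
        HasSum
          (fun β : {β : T.Edge // T.lt α β} =>
            T.rescaled p p' μ β ^ p' *
              ∏ γ ∈ (T.Ico_finite α β).toFinset, (1 - T.rescaled p p' μ γ ^ (p' - 1)) ^ p)
          (T.rescaled p p' μ α * (1 - T.rescaled p p' μ α ^ (p' - 1))) := by
  have h : p.HolderConjugate p' :=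
    Real.holderConjugate_iff.2 ⟨hp, by simpa only [one_div] using hpp'⟩
  rw [RootEdgeTree.exists_isEquilibriumMeasure_iff h μ hμ,
    RootEdgeTree.potentialB_ae_eq_one_iff h.symm.ne_zero μ hμ]
  exact forall_congr' fun α => (RootEdgeTree.hasSum_rescaled_iff h μ hμ α).symm
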